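/- An automaton with $n$ states is a set $\Sigma\subset\{0,1\}^{n\times n}$ of row-stochastic matrices (the letters); a word of length $t$ is a product of $t$ letters, the word of length $0$ being the identity matrix. The automaton is synchronizing if some word has all its rows equal to one and the same standard basis vector, and strongly connected if every state can be reached from every state in the directed graph with an edge from $i$ to $j$ whenever $L_{ij}=1$ for some letter $L\in\Sigma$. The triple rendezvous time $T_3$ of $\Sigma$ is the smallest integer $t\ge 0$ such that some word of length at most $t$ has a column with at least three non-zero entries, i.e. such that some word of length at most $t$ maps three distinct states to one state. Proposition. Let $n\ge 3$ and let $\Sigma$ be a strongly connected synchronizing automaton with $n$ states. Then $T_3$ exists, and for every integer $s$ with $1\le s\le n/2$, $$T_3\le \max\left\{\frac{n(s+2)}{2},\ \frac{n(n+4)-(2s-1)(2s+3)+1}{4}\right\}.$$ -/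

import Mathlib

open scoped BigOperators

noncomputable section

/-- A (deterministic, finite state, complete) automaton with `n` states: a set of
row-stochastic matrices with entries in `{0, 1}`, one for each letter
(such a set is automatically finite). -/
def IsAutomaton {n : ℕ} (S : Set (Matrix (Fin n) (Fin n) ℝ)) : Prop :=
  ∀ L ∈ S, (∀ i j, L i j = 0 ∨ L i j = 1) ∧ ∀ i, ∑ j, L i j = 1

/-- The words of length `t`: the products of `t` letters (the identity matrix for `t = 0`). -/
def wordsOfLength {n : ℕ} (S : Set (Matrix (Fin n) (Fin n) ℝ)) (t : ℕ) :
    Set (Matrix (Fin n) (Fin n) ℝ) :=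
  {W | ∃ l : List (Matrix (Fin n) (Fin n) ℝ), l.length = t ∧ (∀ L ∈ l, L ∈ S) ∧ l.prod = W}

/-- The words of length at most `t`. -/
def wordsUpTo {n : ℕ} (S : Set (Matrix (Fin n) (Fin n) ℝ)) (t : ℕ) :
    Set (Matrix (Fin n) (Fin n) ℝ) :=
  {W | ∃ r, r ≤ t ∧ W ∈ wordsOfLength S r}

/-- Some word maps all states to a single state `i`, i.e. has all its rows equal to the
`i`-th standard basis vector. -/
def IsSynchronizing {n : ℕ} (S : Set (Matrix (Fin n) (Fin n) ℝ)) : Prop :=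
  ∃ (t : ℕ) (W : Matrix (Fin n) (Fin n) ℝ) (i : Fin n),
    W ∈ wordsOfLength S t ∧ W = Matrix.of (fun _ => (Pi.single i 1 : Fin n → ℝ))

/-- Every state can be reached from every state along transitions of the automaton. -/
def IsStronglyConnected {n : ℕ} (S : Set (Matrix (Fin n) (Fin n) ℝ)) : Prop :=
  ∀ i j : Fin n, Relation.ReflTransGen (fun a b => ∃ L ∈ S, L a b = 1) i j

/-- The set `A(t)` of vectors reachable at `t`: the columns of the words of length at most `t`. -/
def reachableVectors {n : ℕ} (S : Set (Matrix (Fin n) (Fin n) ℝ)) (t : ℕ) :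
    Set (Fin n → ℝ) :=
  {v | ∃ W ∈ wordsUpTo S t, ∃ j : Fin n, v = fun i => W i j}

/-- The times `t` at which `A(t)` contains a column of weight at least three; the weight of a
vector is its number of non-zero entries. -/
def tripleTimes {n : ℕ} (S : Set (Matrix (Fin n) (Fin n) ℝ)) : Set ℕ :=
  {t | ∃ v ∈ reachableVectors S t, 3 ≤ hammingNorm v}

/-- The triple rendezvous time `T₃`: the smallest `t` such that `A(t)` contains a column of
weight at least three (meaningful when there is such a `t`). -/
def tripleRendezvousTime {n : ℕ} (S : Set (Matrix (Fin n) (Fin n) ℝ)) : ℕ :=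
  sInf (tripleTimes S)

end

namespace SyncAut

open Finset
open scoped Classical

/-! Suppose that no word of length at most `b` merges three states. The mergeable pairs form a graph
`Adj` that gains an edge at every step, so its degree sum at time `t` is at least `2 * t`
(`two_mul_le_sum_deg`). The theorem follows once degrees are shown to be about `s` at most.

Let `w`, of length at most `j`, give `v` two preimages. A neighbour of `v` at time `t ≤ b - j` lying
in the image of `w` would produce a triple, so `w` has rank at most `n - deg v`. A linear program
bounds the rank from below: for weights whose columns have total at most one, the optimum is `(n +
defect) / 2` by Hall's theorem, and each state in the image of `w` receives at most one unit, so the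
rank is at least `(n + defect) / 2`. Hence `2 * deg v ≤ n - defect`: a large degree means a small
defect already at time `j`.

A small defect leaves little time. The defect never increases, and while it is constant the span of
the optima (`face`) loses a dimension at each step; this span has dimension at most `(n - defect) /
2 + 1`. Summing over the possible defects (`succ_le_add_sum_levels`) gives the quadratic bound
unless degrees stay near `s`.

With `K ≤ n` the largest depth, every state is controlled at time `b - K`, so `2 * (b - K)` is at
most about `n * s`: the first bound up to corrections. The savings in `four_mul_sub_maxDepth_add_le`
absorb these corrections. -/

/-! ### Words as transformations, and mergeable pairs. -/

/-- `IsWord Φ t w`: the transformation `w` is induced by a word of length `t` over `Φ`. -/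
inductive IsWord {V : Type*} (Φ : Set (V → V)) : ℕ → (V → V) → Prop
  | nil : IsWord Φ 0 id
  | cons {t : ℕ} {w f : V → V} : f ∈ Φ → IsWord Φ t w → IsWord Φ (t + 1) (w ∘ f)

/-- Transformations induced by words of length at most `t`. -/
def Reach {V : Type*} (Φ : Set (V → V)) (t : ℕ) (w : V → V) : Prop :=
  ∃ r ≤ t, IsWord Φ r w

/-- Some word maps every state to the same state. -/
def Sync {V : Type*} (Φ : Set (V → V)) : Prop :=
  ∃ (t : ℕ) (w : V → V) (z : V), IsWord Φ t w ∧ ∀ i, w i = z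

/-- Every state is reachable from every state. -/
def Conn {V : Type*} (Φ : Set (V → V)) : Prop :=
  ∀ i j : V, Relation.ReflTransGen (fun a b => ∃ f ∈ Φ, f a = b) i j

/-- Two distinct states merged by a word of length at most `t`. -/
def Adj {V : Type*} (Φ : Set (V → V)) (t : ℕ) (i j : V) : Prop :=
  i ≠ j ∧ ∃ w, Reach Φ t w ∧ w i = w j

section basic

variable {V : Type*} {Φ : Set (V → V)} {s t : ℕ} {v w f : V → V} {i j : V}

theorem IsWord.comp (hv : IsWord Φ s v) (hw : IsWord Φ t w) : IsWord Φ (s + t) (w ∘ v) := by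
  induction hv with
  | nil => simpa using hw
  | @cons s v f hf _ ih =>
    rw [add_right_comm]
    exact IsWord.cons (w := w ∘ v) (f := f) hf ih

theorem IsWord.letter (hf : f ∈ Φ) : IsWord Φ 1 f :=
  IsWord.cons (w := id) hf IsWord.nil

theorem Reach.id : Reach Φ t id := ⟨0, t.zero_le, IsWord.nil⟩

theorem Reach.mono (hst : s ≤ t) (hw : Reach Φ s w) : Reach Φ t w :=
  let ⟨r, hr, h⟩ := hw
  ⟨r, hr.trans hst, h⟩

theorem Reach.comp (hv : Reach Φ s v) (hw : Reach Φ t w) : Reach Φ (s + t) (w ∘ v) :=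
  let ⟨_, hr, h⟩ := hv
  let ⟨_, hr', h'⟩ := hw
  ⟨_, add_le_add hr hr', h.comp h'⟩

theorem Reach.letter (hf : f ∈ Φ) : Reach Φ 1 f := ⟨1, le_rfl, IsWord.letter hf⟩

theorem Adj.mono (hst : s ≤ t) (h : Adj Φ s i j) : Adj Φ t i j :=
  let ⟨hij, w, hw, e⟩ := h
  ⟨hij, w, hw.mono hst, e⟩

theorem Adj.symm (h : Adj Φ t i j) : Adj Φ t j i :=
  let ⟨hij, w, hw, e⟩ := h
  ⟨hij.symm, w, hw, e.symm⟩

theorem adj_succ_of_letter (hf : f ∈ Φ) (hij : i ≠ j) (h : f i = f j ∨ Adj Φ t (f i) (f j)) :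
    Adj Φ (t + 1) i j := by
  rcases h with h | ⟨_, w, hw, e⟩
  · exact ⟨hij, f, (Reach.letter hf).mono (by omega), h⟩
  · exact ⟨hij, w ∘ f, by simpa [add_comm] using (Reach.letter hf).comp hw, e⟩

theorem Adj.exists_letter (h : Adj Φ (t + 1) i j) :
    ∃ f ∈ Φ, f i = f j ∨ Adj Φ t (f i) (f j) := by
  obtain ⟨hij, w, ⟨r, hr, hw⟩, e⟩ := h
  cases hw with
  | nil => exact absurd e hij
  | @cons r w f hf hw =>
    refine ⟨f, hf, ?_⟩
    by_cases h : f i = f j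
    · exact Or.inl h
    · exact Or.inr ⟨h, w, ⟨r, by omega, hw⟩, e⟩

/-- A pair merges within `t + 1` steps exactly when some letter merges it or sends it to a pair
merging within `t`, so one step without new pairs stops the growth for good. -/
theorem adj_stable (h : ∀ i j, Adj Φ (t + 1) i j → Adj Φ t i j) (k : ℕ) :
    ∀ i j, Adj Φ (t + k) i j → Adj Φ t i j := by
  induction k with
  | zero => exact fun _ _ => id
  | succ k ih =>
    intro i j hij
    obtain ⟨f, hf, hfij⟩ := Adj.exists_letter (t := t + k) hij
    exact h i j (adj_succ_of_letter hf hij.1 (hfij.imp_right (ih _ _)))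

theorem exists_noninjective_letter [Nontrivial V] (hs : Sync Φ) :
    ∃ f ∈ Φ, ∃ a b, a ≠ b ∧ f a = f b := by
  by_contra! hcon
  obtain ⟨t, w, z, hw, hz⟩ := hs
  have hinj : Function.Injective w := by
    clear hz
    induction hw with
    | nil => exact Function.injective_id
    | @cons t w f hf hw ih =>
      refine ih.comp fun a b hab => ?_
      by_contra hne
      exact hcon f hf a b hne hab
  obtain ⟨a, b, hab⟩ := exists_pair_ne V
  exact hab (hinj ((hz a).trans (hz b).symm))

end basic

/-! ### Growth of the graph of mergeable pairs. -/

/-- No word of length at most `b` maps three states to one state. -/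
def NoTriple {V : Type*} [Fintype V] (Φ : Set (V → V)) (b : ℕ) : Prop :=
  ∀ w, Reach Φ b w → ∀ j, #{i | w i = j} ≤ 2

section growth

variable {V : Type*} [Fintype V] {Φ : Set (V → V)} {s t b : ℕ}

theorem NoTriple.mono (hst : s ≤ t) (h : NoTriple Φ t) : NoTriple Φ s :=
  fun w hw => h w (hw.mono hst)

theorem NoTriple.false_of_triple {w : V → V} {i j k : V} (h : NoTriple Φ t) (hw : Reach Φ t w)
    (hij : i ≠ j) (hik : i ≠ k) (hjk : j ≠ k) (e₁ : w i = w j) (e₂ : w i = w k) : False := by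
  have h2 := h w hw (w i)
  have : 2 < #{l | w l = w i} :=
    Finset.two_lt_card.2 ⟨i, by simp, j, by simp [e₁], k, by simp [e₂], hij, hik, hjk⟩
  omega

/-- If the graph stopped growing, synchronization would make it complete at time `t`. Then a letter
merging `a` and `c`, followed by a word merging their common image with that of a third state,
yields a triple. -/
theorem exists_new_adj (hV : 3 ≤ Fintype.card V) (hs : Sync Φ) (h : NoTriple Φ (t + 1)) :
    ∃ i j, Adj Φ (t + 1) i j ∧ ¬ Adj Φ t i j := by
  by_contra! hcon
  have : Nontrivial V := Fintype.one_lt_card_iff_nontrivial.1 (by omega)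
  obtain ⟨f, hf, a, c, hac, hfac⟩ := exists_noninjective_letter hs
  have hall : ∀ i j, i ≠ j → Adj Φ t i j := by
    obtain ⟨r, w, z, hw, hz⟩ := hs
    intro i j hij
    refine adj_stable hcon r i j ⟨hij, w, ⟨r, by omega, hw⟩, ?_⟩
    rw [hz, hz]
  obtain ⟨x, hx⟩ : ∃ x, x ∉ ({a, c} : Finset V) := by
    by_contra! hx
    have := Finset.card_le_card (fun y _ => hx y : (univ : Finset V) ⊆ {a, c})
    have := Finset.card_le_two (a := a) (b := c)
    rw [Finset.card_univ] at *
    omega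
  simp only [mem_insert, mem_singleton, not_or] at hx
  by_cases hfx : f a = f x
  · exact h.false_of_triple ((Reach.letter hf).mono (by omega)) hac (Ne.symm hx.1) (Ne.symm hx.2)
      hfac hfx
  · obtain ⟨_, w, hw, e⟩ := hall _ _ hfx
    exact h.false_of_triple (w := w ∘ f)
      (by simpa [add_comm] using (Reach.letter hf).comp hw) hac (Ne.symm hx.1) (Ne.symm hx.2)
      (congrArg w hfac) e

/-- The number of states that can be merged with `i` by a word of length at most `t`. -/
noncomputable def deg (Φ : Set (V → V)) (t : ℕ) (i : V) : ℕ := #{j | Adj Φ t i j}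

theorem deg_mono (hst : s ≤ t) (i : V) : deg Φ s i ≤ deg Φ t i :=
  card_le_card fun j hj => by
    simp only [mem_filter, mem_univ, true_and] at hj ⊢
    exact hj.mono hst

theorem deg_lt {i j : V} (hst : s ≤ t) (h : Adj Φ t i j) (h' : ¬ Adj Φ s i j) :
    deg Φ s i < deg Φ t i := by
  refine card_lt_card ⟨fun k hk => ?_, fun hsub => h' ?_⟩
  · simp only [mem_filter, mem_univ, true_and] at hk ⊢
    exact hk.mono hst
  · have : j ∈ ({j | Adj Φ s i j} : Finset V) := hsub (by simpa using h)
    simpa using this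

theorem deg_le (i : V) : deg Φ t i + 1 ≤ Fintype.card V := by
  have : #{j | Adj Φ t i j} < #(univ : Finset V) := by
    refine card_lt_card ⟨subset_univ _, fun h => ?_⟩
    have : i ∈ ({j | Adj Φ t i j} : Finset V) := h (mem_univ i)
    exact (mem_filter.1 this).2.1 rfl
  simpa [deg, Nat.succ_le_iff] using this

theorem two_mul_le_sum_deg (hV : 3 ≤ Fintype.card V) (hs : Sync Φ) (h : NoTriple Φ t) :
    2 * t ≤ ∑ i, deg Φ t i := by
  induction t with
  | zero => simp
  | succ t ih =>
    obtain ⟨i, j, hij, hn⟩ := exists_new_adj hV hs h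
    have h1 := ih (h.mono (by omega))
    have hi := deg_lt t.le_succ hij hn
    have hj := deg_lt t.le_succ hij.symm (fun h => hn h.symm)
    have hne := hij.1
    have : ∑ k, (deg Φ t k + ((if k = i then 1 else 0) + if k = j then 1 else 0))
        ≤ ∑ k, deg Φ (t + 1) k := by
      refine sum_le_sum fun k _ => ?_
      have := deg_mono (Φ := Φ) t.le_succ k
      by_cases hki : k = i
      · subst hki
        simpa [hne] using hi
      · by_cases hkj : k = j
        · subst hkj
          simpa [hki] using hj
        · simpa [hki, hkj] using this
    simp only [sum_add_distrib, sum_ite_eq', mem_univ, if_true] at this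
    omega

end growth

/-! ### Two dimension estimates. -/

/-- If `h` is injective without fixed points on `M`, the functions supported on `M` that change
sign along `h` form a space of dimension at most `#M / 2`. -/
theorem two_mul_finrank_le {V : Type*} [Fintype V] (M : Finset V) (h : V → V)
    (hinj : Set.InjOn h M) (hfix : ∀ i ∈ M, h i ≠ i) (W : Submodule ℝ (V → ℝ))
    (hW : ∀ x ∈ W, (∀ i ∈ M, x (h i) = - x i) ∧ ∀ i ∉ M, x i = 0) :
    2 * Module.finrank ℝ W ≤ #M := by
  let c : V → Module.Dual ℝ W := fun i => (LinearMap.proj i : (V → ℝ) →ₗ[ℝ] ℝ) ∘ₗ W.subtype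
  have hc : ∀ i (x : W), c i x = (x : V → ℝ) i := fun _ _ => rfl
  have hcM : ∀ i, c i ≠ 0 → i ∈ M := by
    intro i hi
    by_contra hiM
    exact hi (LinearMap.ext fun x => by simpa [hc] using (hW x x.2).2 i hiM)
  have hch : ∀ i ∈ M, c (h i) = - c i := fun i hi =>
    LinearMap.ext fun x => by simpa [hc] using (hW x x.2).1 i hi
  -- The coordinate functionals span the dual of `W`; a basis is chosen among them.
  obtain ⟨κ, a, ha, hspan, hli⟩ := exists_linearIndependent' ℝ c
  have : Finite κ := Finite.of_injective a ha
  have : Fintype κ := Fintype.ofFinite κ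
  have htop : Submodule.span ℝ (Set.range c) = ⊤ := by
    rw [← Subspace.dualCoannihilator_dualAnnihilator_eq (W := Submodule.span ℝ (Set.range c)),
      ← Submodule.dualAnnihilator_bot]
    congr 1
    rw [Submodule.eq_bot_iff]
    intro x hx
    rw [Submodule.mem_dualCoannihilator] at hx
    exact Subtype.ext (funext fun i => hx (c i) (Submodule.subset_span ⟨i, rfl⟩))
  have hcard : Fintype.card κ = Module.finrank ℝ W := by
    have h1 := finrank_span_eq_card hli
    rw [hspan, htop, finrank_top, Subspace.dual_finrank_eq] at h1
    exact h1.symm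
  have hne : ∀ k, c (a k) ≠ 0 := fun k => hli.ne_zero k
  have haM : ∀ k, a k ∈ M := fun k => hcM _ (hne k)
  -- Each basis index `a k` also yields `h (a k)`, whose functional is the negative. A coincidence
  -- `a k = h (a l)` would be a linear dependence if `k ≠ l`, and a fixed point of `h` if `k = l`.
  let F : κ ⊕ κ → V := Sum.elim a (h ∘ a)
  have hF : Function.Injective F := by
    refine Function.Injective.sumElim ha ?_ ?_
    · intro k l hkl
      exact ha (hinj (haM k) (haM l) hkl)
    · intro k l hkl
      have hkl : a k = h (a l) := hkl
      have h1 : c (a k) = - c (a l) := by rw [hkl, hch _ (haM l)]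
      by_cases e : k = l
      · subst e
        exact hfix _ (haM k) hkl.symm
      · have := Fintype.linearIndependent_iff.1 hli (Pi.single k 1 + Pi.single l 1)
          (by simp [add_smul, sum_add_distrib, Pi.single_apply, ite_smul, h1]) k
        simp [e] at this
  have hFM : ∀ y, F y ∈ M := by
    rintro (k | k)
    · exact haM k
    · refine hcM _ ?_
      change c (h (a k)) ≠ 0
      rw [hch _ (haM k)]
      exact neg_ne_zero.2 (hne k)
  have h2 := Finset.card_le_card_of_injOn (s := (univ : Finset (κ ⊕ κ))) (t := M) F
    (fun y _ => hFM y) hF.injOn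
  simp only [Finset.card_univ, Fintype.card_sum, hcard] at h2
  omega

theorem finrank_le_finrank_ker_add_one {E : Type*} [AddCommGroup E] [Module ℝ E]
    [FiniteDimensional ℝ E] (U : Submodule ℝ E) (φ : E →ₗ[ℝ] ℝ) :
    Module.finrank ℝ U ≤ Module.finrank ℝ (U ⊓ LinearMap.ker φ : Submodule ℝ E) + 1 := by
  have h1 := LinearMap.finrank_range_add_finrank_ker (φ.domRestrict U)
  have h2 : Module.finrank ℝ (LinearMap.range (φ.domRestrict U)) ≤ 1 := by
    simpa using Submodule.finrank_le (LinearMap.range (φ.domRestrict U))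
  have h3 : (LinearMap.ker (φ.domRestrict U)).map U.subtype = U ⊓ LinearMap.ker φ := by
    rw [LinearMap.ker_domRestrict, Submodule.map_comap_subtype]
  have h4 := Submodule.finrank_map_subtype_eq U (LinearMap.ker (φ.domRestrict U))
  rw [h3] at h4
  omega

/-! ### Hall's theorem with deficiency. -/

section matching

variable {V : Type*} [Fintype V] {Φ : Set (V → V)} {s t b : ℕ}

/-- The states that can be merged with an element of `S` by a word of length at most `t`. -/
noncomputable def nbr (Φ : Set (V → V)) (t : ℕ) (S : Finset V) : Finset V :=
  {j | ∃ i ∈ S, Adj Φ t i j}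

/-- The largest defect `#S - #(nbr Φ t S)` of a set `S` of states. -/
noncomputable def defect (Φ : Set (V → V)) (t : ℕ) : ℕ :=
  (univ : Finset (Finset V)).sup fun S => #S - #(nbr Φ t S)

theorem card_le_defect (S : Finset V) : #S ≤ #(nbr Φ t S) + defect Φ t := by
  have : #S - #(nbr Φ t S) ≤ defect Φ t :=
    Finset.le_sup (f := fun S => #S - #(nbr Φ t S)) (mem_univ S)
  omega

theorem exists_eq_defect : ∃ S : Finset V, #S = #(nbr Φ t S) + defect Φ t := by
  by_cases h0 : defect Φ t = 0
  · refine ⟨∅, ?_⟩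
    have : nbr Φ t ∅ = ∅ := by simp [nbr]
    simp [this, h0]
  · obtain ⟨S, -, hS⟩ := Finset.exists_mem_eq_sup (univ : Finset (Finset V))
      ⟨∅, mem_univ _⟩ (fun S => #S - #(nbr Φ t S))
    have hS : defect Φ t = #S - #(nbr Φ t S) := hS
    exact ⟨S, by omega⟩

theorem exists_matching : ∃ (M : Finset V) (h : V → V), Set.InjOn h M ∧
    (∀ i ∈ M, Adj Φ t i (h i)) ∧ Fintype.card V ≤ #M + defect Φ t := by
  -- Adding `defect` dummy partners available to every state restores Hall's condition; `M` will be
  -- the states not matched to a dummy.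
  let T : V → Finset (V ⊕ Fin (defect Φ t)) := fun i => (nbr Φ t {i}).disjSum univ
  obtain ⟨g, hg, hgT⟩ := (Finset.all_card_le_biUnion_card_iff_exists_injective T).1 (by
    intro S
    rcases S.eq_empty_or_nonempty with rfl | ⟨i₀, hi₀⟩
    · simp
    have : (nbr Φ t S).disjSum (univ : Finset (Fin (defect Φ t))) ⊆ S.biUnion T := by
      intro y hy
      rcases y with j | d
      · simp only [nbr, inl_mem_disjSum, mem_filter, mem_univ, true_and] at hy
        obtain ⟨i, hi, hij⟩ := hy
        exact mem_biUnion.2 ⟨i, hi, by simpa [T, nbr] using hij⟩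
      · exact mem_biUnion.2 ⟨i₀, hi₀, by simp [T]⟩
    have := card_le_card this
    rw [card_disjSum, card_univ, Fintype.card_fin] at this
    exact (card_le_defect S).trans this)
  have hadj : ∀ i j, g i = Sum.inl j → Adj Φ t i j := by
    intro i j hij
    have := hgT i
    rw [hij] at this
    simpa [T, nbr] using this
  let M : Finset V := {i | ∃ j, g i = Sum.inl j}
  have hM : ∀ i ∈ M, ∃ j, g i = Sum.inl j := fun i hi => by simpa [M] using hi
  let h : V → V := fun i => if hi : ∃ j, g i = Sum.inl j then hi.choose else i
  have hh : ∀ i ∈ M, g i = Sum.inl (h i) := by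
    intro i hi
    have := hM i hi
    simp only [h, dif_pos this]
    exact this.choose_spec
  refine ⟨M, h, ?_, fun i hi => hadj _ _ (hh i hi), ?_⟩
  · intro i hi j hj hij
    exact hg (by rw [hh i hi, hh j hj, hij])
  · have h1 : #Mᶜ ≤ #((univ : Finset (Fin (defect Φ t))).map Function.Embedding.inr :
        Finset (V ⊕ Fin (defect Φ t))) := by
      refine card_le_card_of_injOn g ?_ hg.injOn
      intro i hi
      have hi : ∀ j, g i ≠ Sum.inl j := by simpa [M] using hi
      rcases hgi : g i with j | d
      · exact absurd hgi (hi j)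
      · simp
    rw [card_map, card_univ, Fintype.card_fin] at h1
    have := card_add_card_compl M
    omega

end matching

/-! ### The linear program, its optima, and the time each defect can last. -/

section faces

variable {V : Type*} [Fintype V] {Φ : Set (V → V)} {s t b : ℕ}

/-- Nonnegative weights for which every column of a word of length at most `t` has total weight
at most one. -/
def Feas (Φ : Set (V → V)) (t : ℕ) (x : V → ℝ) : Prop :=
  (∀ i, 0 ≤ x i) ∧ ∀ w, Reach Φ t w → ∀ j, ∑ i with w i = j, x i ≤ 1

variable {x : V → ℝ}

theorem Feas.anti (hst : s ≤ t) (h : Feas Φ t x) : Feas Φ s x :=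
  ⟨h.1, fun w hw => h.2 w (hw.mono hst)⟩

theorem Feas.le_one (h : Feas Φ t x) (i : V) : x i ≤ 1 := by
  have := h.2 id Reach.id i
  simpa using (single_le_sum (f := x) (fun j _ => h.1 j) (by simp)).trans this

theorem Feas.add_le_one (h : Feas Φ t x) {i j : V} (hij : Adj Φ t i j) : x i + x j ≤ 1 := by
  obtain ⟨hne, w, hw, e⟩ := hij
  have h1 := h.2 w hw (w j)
  have h2 : ∑ k ∈ {i, j}, x k ≤ ∑ k with w k = w j, x k :=
    sum_le_sum_of_subset_of_nonneg (by
      intro k hk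
      simp only [mem_insert, mem_singleton] at hk
      rcases hk with rfl | rfl <;> simp [e]) (fun k _ _ => h.1 k)
  rw [sum_pair hne] at h2
  linarith

/-- The linear map pushing weights forward along `f`. -/
noncomputable def push (f : V → V) : (V → ℝ) →ₗ[ℝ] (V → ℝ) where
  toFun x j := ∑ i with f i = j, x i
  map_add' x y := by ext j; simp [sum_add_distrib]
  map_smul' c x := by ext j; simp [mul_sum]

theorem sum_push_filter (f w : V → V) (x : V → ℝ) (j : V) :
    ∑ i with w i = j, push f x i = ∑ i with (w ∘ f) i = j, x i := by
  simp only [push, LinearMap.coe_mk, AddHom.coe_mk, sum_filter]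
  simp only [← sum_filter, Function.comp]
  rw [sum_comm' (t' := univ.filter fun i => w (f i) = j) (s' := fun i => {f i})]
  · simp
  · intro a c
    simp only [mem_filter, mem_univ, true_and, mem_singleton]
    constructor
    · rintro ⟨h1, rfl⟩; exact ⟨rfl, h1⟩
    · rintro ⟨rfl, h1⟩; exact ⟨h1, rfl⟩

theorem sum_push (f : V → V) (x : V → ℝ) : ∑ i, push f x i = ∑ i, x i := by
  simp only [push, LinearMap.coe_mk, AddHom.coe_mk]
  exact sum_fiberwise univ f x

theorem Feas.push {f : V → V} (hf : f ∈ Φ) (h : Feas Φ (t + 1) x) : Feas Φ t (push f x) := by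
  refine ⟨fun j => sum_nonneg fun i _ => h.1 i, fun w hw j => ?_⟩
  rw [sum_push_filter]
  exact h.2 _ (by simpa [add_comm] using (Reach.letter hf).comp hw) j

/-- The feasible weights of maximal total weight. -/
def optima (Φ : Set (V → V)) (t : ℕ) : Set (V → ℝ) :=
  {x | Feas Φ t x ∧ 2 * ∑ i, x i = Fintype.card V + defect Φ t}

/-- The span of the feasible weights of maximal total weight. -/
def face (Φ : Set (V → V)) (t : ℕ) : Submodule ℝ (V → ℝ) := Submodule.span ℝ (optima Φ t)

/-- The slack identity behind weak duality. -/
theorem sum_slack (M : Finset V) (h : V → V) (hinj : Set.InjOn h M) (x : V → ℝ) :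
    ∑ i ∈ M, (1 - x i - x (h i)) + ∑ i ∈ Mᶜ, (1 - x i) + ∑ j ∈ (M.image h)ᶜ, (1 - x j)
      = 2 * Fintype.card V - #M - 2 * ∑ i, x i := by
  have h1 := sum_add_sum_compl M fun i => 1 - x i
  have h2 := sum_add_sum_compl (M.image h) fun i => 1 - x i
  rw [sum_image hinj] at h2
  simp only [sum_sub_distrib, sum_const, card_univ, nsmul_eq_mul, mul_one] at *
  linarith

/-- Weak duality: the matching is a dual solution, and all slacks in `sum_slack` are nonnegative. -/
theorem Feas.two_mul_sum_le (h : Feas Φ t x) :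
    2 * ∑ i, x i ≤ Fintype.card V + defect Φ t := by
  obtain ⟨M, g, hinj, hadj, hM⟩ := exists_matching (Φ := Φ) (t := t)
  have hs := sum_slack M g hinj x
  have h1 : 0 ≤ ∑ i ∈ M, (1 - x i - x (g i)) :=
    sum_nonneg fun i hi => by linarith [h.add_le_one (hadj i hi)]
  have h2 : 0 ≤ ∑ i ∈ Mᶜ, (1 - x i) := sum_nonneg fun i _ => by linarith [h.le_one i]
  have h3 : 0 ≤ ∑ i ∈ (M.image g)ᶜ, (1 - x i) := sum_nonneg fun i _ => by linarith [h.le_one i]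
  have : (Fintype.card V : ℝ) ≤ #M + defect Φ t := by exact_mod_cast hM
  linarith

/-- Without triples the only constraints are `x i ≤ 1` and `x i + x j ≤ 1` on edges, and a set `S`
attaining the defect gives a half-integral optimum. -/
theorem optima_nonempty (h : NoTriple Φ t) : (optima Φ t).Nonempty := by
  obtain ⟨S, hS⟩ := exists_eq_defect (Φ := Φ) (t := t)
  let N := nbr Φ t S
  let x : V → ℝ := fun i => ((if i ∈ S then 1 else 0) + 1 - if i ∈ N then 1 else 0) / 2
  have hx0 : ∀ i, 0 ≤ x i := by
    intro i; simp only [x]; split_ifs <;> norm_num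
  have hx1 : ∀ i, x i ≤ 1 := by
    intro i; simp only [x]; split_ifs <;> norm_num
  have hx2 : ∀ i j, Adj Φ t i j → x i + x j ≤ 1 := by
    intro i j hij
    have h1 : i ∈ S → j ∈ N := fun hi => by simpa [N, nbr] using ⟨i, hi, hij⟩
    have h2 : j ∈ S → i ∈ N := fun hi => by simpa [N, nbr] using ⟨j, hi, hij.symm⟩
    simp only [x]
    by_cases hi : i ∈ S <;> by_cases hj : j ∈ S <;> by_cases hi' : i ∈ N <;>
      by_cases hj' : j ∈ N <;> simp [hi, hj, hi', hj'] at h1 h2 ⊢ <;> norm_num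
  refine ⟨x, ⟨hx0, fun w hw j => ?_⟩, ?_⟩
  · have hc := h w hw j
    rcases Nat.lt_or_ge (#{i | w i = j}) 2 with h1 | h1
    · rcases Nat.lt_or_ge (#{i | w i = j}) 1 with h0 | h0
      · rw [card_eq_zero.1 (by omega : #{i | w i = j} = 0)]
        simp
      · obtain ⟨a, ha⟩ := card_eq_one.1 (by omega : #{i | w i = j} = 1)
        rw [ha, sum_singleton]
        exact hx1 a
    · obtain ⟨a, c, hac, e⟩ := card_eq_two.1 (by omega : #{i | w i = j} = 2)
      have ha : w a = j := by
        have : a ∈ ({i | w i = j} : Finset V) := by rw [e]; simp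
        simpa using this
      have hb : w c = j := by
        have : c ∈ ({i | w i = j} : Finset V) := by rw [e]; simp
        simpa using this
      rw [e, sum_pair hac]
      exact hx2 a c ⟨hac, w, hw, ha.trans hb.symm⟩
  · have hS' : (#S : ℝ) = #N + defect Φ t := by exact_mod_cast hS
    have : ∑ i, x i = (#S + Fintype.card V - #N) / 2 := by
      simp only [x, ← sum_div, sum_sub_distrib, sum_add_distrib]
      simp
    rw [this, hS']
    ring

/-- Feasibility becomes stricter with time, while the optimal value is `(n + defect) / 2`. -/
theorem defect_anti (h : NoTriple Φ (t + 1)) : defect Φ (t + 1) ≤ defect Φ t := by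
  obtain ⟨x, hx, hs⟩ := optima_nonempty h
  have := (hx.anti t.le_succ).two_mul_sum_le
  rw [hs] at this
  exact_mod_cast (by linarith : (defect Φ (t + 1) : ℝ) ≤ defect Φ t)

theorem defect_le : defect Φ t ≤ Fintype.card V := by
  obtain ⟨S, hS⟩ := exists_eq_defect (Φ := Φ) (t := t)
  have := card_le_univ S
  omega

theorem two_mul_deficiency_le (h : NoTriple Φ t) {w : V → V} (hw : Reach Φ t w) :
    defect Φ t + Fintype.card V ≤ 2 * #(univ.image w) := by
  obtain ⟨x, hx, hs⟩ := optima_nonempty h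
  have h1 : ∑ i, x i = ∑ j ∈ univ.image w, ∑ i with w i = j, x i :=
    (sum_fiberwise_of_maps_to (fun i _ => mem_image_of_mem w (mem_univ i)) x).symm
  have h2 : ∑ j ∈ univ.image w, ∑ i with w i = j, x i ≤ ∑ j ∈ univ.image w, 1 :=
    sum_le_sum fun j _ => hx.2 w hw j
  simp only [sum_const, nsmul_eq_mul, mul_one] at h2
  have : (defect Φ t + Fintype.card V : ℝ) ≤ 2 * #(univ.image w) := by linarith
  exact_mod_cast this

/-- Complementary slackness: an optimum makes the matching constraints tight, so elements of the
face with zero total change sign along `g` and vanish off `M`. The extra one is the dimension lost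
by imposing zero total. -/
theorem finrank_face_le [Nonempty V] :
    Module.finrank ℝ (face Φ t) ≤ (Fintype.card V - defect Φ t) / 2 + 1 := by
  obtain ⟨M, g, hinj, hadj, hM⟩ := exists_matching (Φ := Φ) (t := t)
  rcases (optima Φ t).eq_empty_or_nonempty with h0 | ⟨x₀, hx₀⟩
  · have : face Φ t = ⊥ := by rw [face, h0, Submodule.span_empty]
    rw [this]
    simp
  have hMc : (Fintype.card V : ℝ) ≤ #M + defect Φ t := by exact_mod_cast hM
  have key : ∀ x ∈ optima Φ t, #M + defect Φ t ≤ (Fintype.card V : ℝ) ∧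
      (∀ i ∈ M, x i + x (g i) = 1) ∧ ∀ i ∉ M, x i = 1 := by
    rintro x ⟨h, hs⟩
    have hsl := sum_slack M g hinj x
    have p1 : ∀ i ∈ M, 0 ≤ 1 - x i - x (g i) := fun i hi => by linarith [h.add_le_one (hadj i hi)]
    have p2 : ∀ i ∈ Mᶜ, 0 ≤ 1 - x i := fun i _ => by linarith [h.le_one i]
    have h1 := sum_nonneg p1
    have h2 := sum_nonneg p2
    have h3 : 0 ≤ ∑ i ∈ (M.image g)ᶜ, (1 - x i) :=
      sum_nonneg fun i _ => by linarith [h.le_one i]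
    refine ⟨by linarith, fun i hi => ?_, fun i hi => ?_⟩
    · have := (sum_eq_zero_iff_of_nonneg p1).1 (by linarith) i hi
      linarith
    · have := (sum_eq_zero_iff_of_nonneg p2).1 (by linarith) i (mem_compl.2 hi)
      linarith
  have hMle : #M ≤ Fintype.card V - defect Φ t := by
    have := (key x₀ hx₀).1
    have : #M + defect Φ t ≤ Fintype.card V := by exact_mod_cast this
    omega
  have hpos : (0 : ℝ) < Fintype.card V + defect Φ t := by
    have : 0 < Fintype.card V := Fintype.card_pos
    positivity
  let φ : (V → ℝ) →ₗ[ℝ] ℝ := ∑ i, LinearMap.proj i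
  have hφ : ∀ x, φ x = ∑ i, x i := fun x => by simp [φ]
  have hface : ∀ x ∈ face Φ t,
      (∀ i ∈ M, (Fintype.card V + defect Φ t) * (x i + x (g i)) = 2 * φ x) ∧
        ∀ i ∉ M, (Fintype.card V + defect Φ t) * x i = 2 * φ x := by
    intro x hx
    induction hx using Submodule.span_induction with
    | mem x hx =>
      obtain ⟨-, h1, h2⟩ := key x hx
      refine ⟨fun i hi => ?_, fun i hi => ?_⟩
      · rw [h1 i hi, hφ, hx.2, mul_one]
      · rw [h2 i hi, hφ, hx.2, mul_one]
    | zero => simp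
    | add x y _ _ hx hy =>
      refine ⟨fun i hi => ?_, fun i hi => ?_⟩
      · have := hx.1 i hi; have := hy.1 i hi
        simp only [Pi.add_apply, map_add]; linarith
      · have := hx.2 i hi; have := hy.2 i hi
        simp only [Pi.add_apply, map_add]; linarith
    | smul c x _ hx =>
      refine ⟨fun i hi => ?_, fun i hi => ?_⟩
      · have := hx.1 i hi
        simp only [Pi.smul_apply, map_smul, smul_eq_mul]; linear_combination c * this
      · have := hx.2 i hi
        simp only [Pi.smul_apply, map_smul, smul_eq_mul]; linear_combination c * this
  have h1 := finrank_le_finrank_ker_add_one (face Φ t) φ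
  have h2 := two_mul_finrank_le M g hinj (fun i hi => (hadj i hi).1.symm)
    (face Φ t ⊓ LinearMap.ker φ) (by
      rintro x ⟨hx, hk⟩
      have hk : φ x = 0 := hk
      obtain ⟨e1, e2⟩ := hface x hx
      rw [hk] at e1 e2
      refine ⟨fun i hi => ?_, fun i hi => ?_⟩
      · have := e1 i hi
        rw [mul_zero, mul_eq_zero] at this
        have := this.resolve_left hpos.ne'
        linarith
      · have := e2 i hi
        rw [mul_zero, mul_eq_zero] at this
        exact this.resolve_left hpos.ne')
  omega

theorem one_le_finrank_face [Nonempty V] (h : NoTriple Φ t) :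
    1 ≤ Module.finrank ℝ (face Φ t) := by
  obtain ⟨x, hx⟩ := optima_nonempty h
  by_contra hcon
  have h0 : face Φ t = ⊥ := Submodule.finrank_eq_zero.1 (by omega)
  have hx0 : x = 0 := by
    have : x ∈ face Φ t := Submodule.subset_span hx
    rwa [h0, Submodule.mem_bot] at this
  have := hx.2
  have hpos : 0 < Fintype.card V := Fintype.card_pos
  have : (0 : ℝ) < Fintype.card V + defect Φ t := by positivity
  simp [hx0] at *
  linarith

theorem push_single (f : V → V) (i : V) : push f (Pi.single i 1) = Pi.single (f i) 1 := by
  ext j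
  simp only [push, LinearMap.coe_mk, AddHom.coe_mk, sum_filter]
  rw [sum_eq_single i]
  · by_cases h : f i = j
    · subst h; simp
    · simp [h, Ne.symm h]
  · intro k _ hk
    simp [hk]
  · simp

theorem push_comp (f w : V → V) (x : V → ℝ) : push w (push f x) = push (w ∘ f) x := by
  ext j
  exact sum_push_filter f w x j

/-- Letters push optima at `t + 1` to optima at `t`. Were the dimensions equal, the face would be
invariant under all letters; a synchronizing word would put a basis vector in it, and connectivity
all of them, against `finrank_face_le` when `n ≥ 3`. -/
theorem finrank_face_lt (hV : 3 ≤ Fintype.card V) (hs : Sync Φ) (hc : Conn Φ)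
    (h : NoTriple Φ (t + 1)) (hd : defect Φ (t + 1) = defect Φ t) :
    Module.finrank ℝ (face Φ (t + 1)) < Module.finrank ℝ (face Φ t) := by
  have : Nonempty V := Fintype.card_pos_iff.1 (by omega)
  have hle : face Φ (t + 1) ≤ face Φ t := Submodule.span_mono fun x hx =>
    ⟨hx.1.anti t.le_succ, by rw [hx.2, hd]⟩
  have hpush : ∀ f ∈ Φ, ∀ x ∈ face Φ (t + 1), push f x ∈ face Φ t := by
    intro f hf x hx
    have : face Φ (t + 1) ≤ (face Φ t).comap (push f) := Submodule.span_le.2 fun y hy =>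
      Submodule.subset_span ⟨hy.1.push hf, by rw [sum_push, hy.2, hd]⟩
    exact this hx
  by_contra hcon
  have heq : face Φ (t + 1) = face Φ t :=
    Submodule.eq_of_le_of_finrank_le hle (not_lt.1 hcon)
  rw [heq] at hpush
  have hword : ∀ r w, IsWord Φ r w → ∀ x ∈ face Φ t, push w x ∈ face Φ t := by
    intro r w hw
    induction hw with
    | nil =>
      intro x hx
      have : push id x = x := by ext j; simp [push, sum_filter]
      rwa [this]
    | @cons r w f hf _ ih =>
      intro x hx
      rw [← push_comp]
      exact ih _ (hpush f hf x hx)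
  obtain ⟨x, hx⟩ := optima_nonempty h
  have hxf : x ∈ face Φ t := heq ▸ Submodule.subset_span hx
  obtain ⟨r, w, z, hw, hz⟩ := hs
  have hsum : (∑ i, x i) ≠ 0 := by
    have h1 := hx.2
    have hpos : 0 < Fintype.card V := Fintype.card_pos
    have : (0 : ℝ) < Fintype.card V + defect Φ (t + 1) := by positivity
    intro h0
    rw [h0] at h1
    linarith
  have hz1 : (Pi.single z 1 : V → ℝ) ∈ face Φ t := by
    have h1 := hword r w hw x hxf
    have h2 : push w x = (∑ i, x i) • (Pi.single z 1 : V → ℝ) := by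
      ext j
      by_cases hj : z = j
      · subst hj; simp [push, hz]
      · simp [push, hz, hj, Ne.symm hj]
    rw [h2] at h1
    exact (Submodule.smul_mem_iff _ hsum).1 h1
  have hall : ∀ i, (Pi.single i 1 : V → ℝ) ∈ face Φ t := by
    intro i
    induction hc z i with
    | refl => exact hz1
    | tail _ hstep ih =>
      obtain ⟨f, hf, rfl⟩ := hstep
      rw [← push_single]
      exact hpush f hf _ ih
  have htop : face Φ t = ⊤ := by
    rw [eq_top_iff]
    intro y _
    rw [pi_eq_sum_univ' y]
    exact Submodule.sum_mem _ fun i _ => Submodule.smul_mem _ _ (hall i)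
  have h1 := finrank_face_le (Φ := Φ) (t := t)
  rw [htop, finrank_top, Module.finrank_fintype_fun_eq_card] at h1
  omega

/-- While no word maps three states to one, the defect and the dimension of the face of optima
bound the remaining time. -/
theorem succ_le_add_sum_levels (hV : 3 ≤ Fintype.card V) (hs : Sync Φ) (hc : Conn Φ)
    (h : NoTriple Φ b) {j : ℕ} (hj : j ≤ b) :
    b + 1 ≤ j + ∑ m ∈ Icc (Fintype.card V - defect Φ j) (Fintype.card V), (m / 2 + 1) := by
  have : Nonempty V := Fintype.card_pos_iff.1 (by omega)
  have hIcc : ∀ t, ∑ m ∈ Icc (Fintype.card V - defect Φ t) (Fintype.card V), (m / 2 + 1)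
      = ((Fintype.card V - defect Φ t) / 2 + 1)
        + ∑ m ∈ Ioc (Fintype.card V - defect Φ t) (Fintype.card V), (m / 2 + 1) := by
    intro t
    rw [← Ioc_insert_left (Nat.sub_le _ _), sum_insert (by simp)]
  -- For the induction, the term of the current defect is replaced by the actual dimension of the
  -- face, a potential that drops at every step.
  have main : ∀ d j, j + d = b → b + 1 ≤ j +
      (∑ m ∈ Ioc (Fintype.card V - defect Φ j) (Fintype.card V), (m / 2 + 1)
        + Module.finrank ℝ (face Φ j)) := by
    intro d
    induction d with
    | zero =>
      rintro j rfl
      have := one_le_finrank_face h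
      rw [add_zero] at *
      omega
    | succ d ih =>
      rintro j hjd
      have h1 := ih (j + 1) (by omega)
      have hj1 : NoTriple Φ (j + 1) := h.mono (by omega)
      have hj0 : NoTriple Φ j := h.mono (by omega)
      have hle := defect_anti hj1
      rcases hle.eq_or_lt with he | hlt
      · have := finrank_face_lt hV hs hc hj1 he
        rw [he] at h1
        omega
      · have h2 := finrank_face_le (Φ := Φ) (t := j + 1)
        have h3 := one_le_finrank_face hj0
        have h4 := hIcc (j + 1)
        have h5 : Icc (Fintype.card V - defect Φ (j + 1)) (Fintype.card V)
            ⊆ Ioc (Fintype.card V - defect Φ j) (Fintype.card V) := by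
          intro m hm
          have := defect_le (Φ := Φ) (t := j)
          simp only [mem_Icc, mem_Ioc] at hm ⊢
          omega
        have h6 := sum_le_sum_of_subset (f := fun m => m / 2 + 1) h5
        omega
  have h1 := main (b - j) j (by omega)
  have h2 := finrank_face_le (Φ := Φ) (t := j)
  rw [hIcc]
  omega

end faces

/-! ### Depths of states, and the degree bounds they give. -/

section depth

variable {V : Type*} [Fintype V] {Φ : Set (V → V)} {s t b j : ℕ} {v : V}

/-- The states with at least two preimages under some word of length at most `j`. -/
noncomputable def doubled (Φ : Set (V → V)) (j : ℕ) : Finset V :=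
  {v | ∃ w, Reach Φ j w ∧ ∃ a c, a ≠ c ∧ w a = v ∧ w c = v}

theorem mem_doubled :
    v ∈ doubled Φ j ↔ ∃ w, Reach Φ j w ∧ ∃ a c, a ≠ c ∧ w a = v ∧ w c = v := by
  simp [doubled]

theorem doubled_mono (hst : s ≤ t) : doubled Φ s ⊆ doubled Φ t := fun v hv => by
  obtain ⟨w, hw, h⟩ := mem_doubled.1 hv
  exact mem_doubled.2 ⟨w, hw.mono hst, h⟩

theorem doubled_zero : doubled Φ 0 = ∅ := by
  ext v
  simp only [mem_doubled, notMem_empty, iff_false]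
  rintro ⟨w, ⟨r, hr, hw⟩, a, c, hac, ha, hc⟩
  obtain rfl : r = 0 := by omega
  cases hw
  exact hac (ha.trans hc.symm)

theorem letter_mem_doubled {f : V → V} (hf : f ∈ Φ) (hv : v ∈ doubled Φ j) :
    f v ∈ doubled Φ (j + 1) := by
  obtain ⟨w, hw, a, c, hac, ha, hc⟩ := mem_doubled.1 hv
  exact mem_doubled.2 ⟨f ∘ w, hw.comp (Reach.letter hf), a, c, hac, congrArg f ha, congrArg f hc⟩

theorem exists_mem_doubled_succ (hc : Conn Φ) {u : V} (hv : v ∈ doubled Φ j)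
    (hu : u ∉ doubled Φ j) : ∃ x, x ∈ doubled Φ (j + 1) ∧ x ∉ doubled Φ j := by
  by_contra! hcon
  refine hu ?_
  clear hu
  induction hc v u with
  | refl => exact hv
  | tail _ hstep ih =>
    obtain ⟨f, hf, rfl⟩ := hstep
    exact hcon _ (letter_mem_doubled hf ih)

/-- The length of a shortest word under which `v` has at least two preimages. -/
noncomputable def depth (Φ : Set (V → V)) (v : V) : ℕ := sInf {j | v ∈ doubled Φ j}

theorem exists_mem_doubled (hV : 3 ≤ Fintype.card V) (hs : Sync Φ) (hc : Conn Φ) (v : V) :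
    ∃ j, v ∈ doubled Φ j := by
  have : Nontrivial V := Fintype.one_lt_card_iff_nontrivial.1 (by omega)
  obtain ⟨f, hf, a, c, hac, e⟩ := exists_noninjective_letter hs
  induction hc (f a) v with
  | refl => exact ⟨1, mem_doubled.2 ⟨f, Reach.letter hf, a, c, hac, rfl, e.symm⟩⟩
  | tail _ hstep ih =>
    obtain ⟨g, hg, rfl⟩ := hstep
    obtain ⟨j, hj⟩ := ih
    exact ⟨j + 1, letter_mem_doubled hg hj⟩

theorem mem_doubled_iff_depth_le (hV : 3 ≤ Fintype.card V) (hs : Sync Φ) (hc : Conn Φ) :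
    v ∈ doubled Φ j ↔ depth Φ v ≤ j :=
  ⟨fun h => Nat.sInf_le h, fun h => doubled_mono h (Nat.sInf_mem (exists_mem_doubled hV hs hc v))⟩

/-- By connectivity `doubled` grows strictly until it contains every state, so depths have no gaps.
-/
theorem exists_depth_eq (hV : 3 ≤ Fintype.card V) (hs : Sync Φ) (hc : Conn Φ)
    (hj : 1 ≤ j) (hv : j ≤ depth Φ v) : ∃ u, depth Φ u = j := by
  obtain ⟨i, rfl⟩ : ∃ i, j = i + 1 := ⟨j - 1, by omega⟩
  suffices ∃ x, x ∈ doubled Φ (i + 1) ∧ x ∉ doubled Φ i by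
    obtain ⟨x, hx, hx'⟩ := this
    rw [mem_doubled_iff_depth_le hV hs hc] at hx hx'
    exact ⟨x, by omega⟩
  rcases (doubled Φ i).eq_empty_or_nonempty with h0 | ⟨u, hu⟩
  · have : Nontrivial V := Fintype.one_lt_card_iff_nontrivial.1 (by omega)
    obtain ⟨f, hf, a, c, hac, e⟩ := exists_noninjective_letter hs
    exact ⟨f a, mem_doubled.2 ⟨f, (Reach.letter hf).mono (by omega), a, c, hac, rfl, e.symm⟩,
      by simp [h0]⟩
  · refine exists_mem_doubled_succ hc hu (u := v) ?_
    rw [mem_doubled_iff_depth_le hV hs hc]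
    omega

theorem one_le_depth (hV : 3 ≤ Fintype.card V) (hs : Sync Φ) (hc : Conn Φ) (v : V) :
    1 ≤ depth Φ v := by
  by_contra h
  have : v ∈ doubled Φ 0 := (mem_doubled_iff_depth_le hV hs hc).2 (by omega)
  simp [doubled_zero] at this

/-- The largest depth of a state. -/
noncomputable def maxDepth (Φ : Set (V → V)) : ℕ := univ.sup (depth Φ)

theorem depth_le_maxDepth (v : V) : depth Φ v ≤ maxDepth Φ := le_sup (mem_univ v)

theorem exists_depth_eq_of_mem_Icc (hV : 3 ≤ Fintype.card V) (hs : Sync Φ) (hc : Conn Φ)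
    (hj : j ∈ Icc 1 (maxDepth Φ)) : ∃ u, depth Φ u = j := by
  have : Nonempty V := Fintype.card_pos_iff.1 (by omega)
  obtain ⟨v, -, hv⟩ := exists_mem_eq_sup (univ : Finset V) univ_nonempty (depth Φ)
  rw [mem_Icc] at hj
  exact exists_depth_eq hV hs hc hj.1 (hj.2.trans hv.le)

theorem card_le_card_filter_depth (hV : 3 ≤ Fintype.card V) (hs : Sync Φ) (hc : Conn Φ)
    {J : Finset ℕ} (hJ : J ⊆ Icc 1 (maxDepth Φ)) : #J ≤ #{v | depth Φ v ∈ J} := by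
  refine card_le_card_of_surjOn (depth Φ) fun j hj => ?_
  obtain ⟨u, rfl⟩ := exists_depth_eq_of_mem_Icc hV hs hc (hJ hj)
  exact ⟨u, by simpa using hj, rfl⟩

theorem maxDepth_le (hV : 3 ≤ Fintype.card V) (hs : Sync Φ) (hc : Conn Φ) :
    maxDepth Φ ≤ Fintype.card V := by
  have := card_le_card_filter_depth hV hs hc (Subset.refl (Icc 1 (maxDepth Φ)))
  have := card_le_univ ({v | depth Φ v ∈ Icc 1 (maxDepth Φ)} : Finset V)
  simp at *
  omega

theorem card_doubled_add_le (hV : 3 ≤ Fintype.card V) (hs : Sync Φ) (hc : Conn Φ) :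
    #(doubled Φ j) + (maxDepth Φ - j) ≤ Fintype.card V := by
  have h1 := card_le_card_filter_depth hV hs hc (J := Ioc j (maxDepth Φ)) (fun i hi => by
    rw [mem_Ioc] at hi
    rw [mem_Icc]
    omega)
  have h2 : Disjoint (doubled Φ j) ({v | depth Φ v ∈ Ioc j (maxDepth Φ)} : Finset V) := by
    rw [disjoint_left]
    intro v hv hv'
    rw [mem_doubled_iff_depth_le hV hs hc] at hv
    simp at hv'
    omega
  have h3 := card_le_univ (doubled Φ j ∪ ({v | depth Φ v ∈ Ioc j (maxDepth Φ)} : Finset V))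
  rw [card_union_of_disjoint h2] at h3
  rw [Nat.card_Ioc] at h1
  omega

theorem four_mul_sum_levels {d n : ℕ} (h : 2 * d ≤ n) :
    4 * ∑ m ∈ Icc (2 * d) n, (m / 2 + 1) + 4 * d ^ 2 + 4 * d + n % 2 = n ^ 2 + 4 * n + 4 := by
  induction n, h using Nat.le_induction with
  | base =>
    simp
    ring
  | succ n hn ih =>
    rw [← insert_Icc_right_eq_Icc_add_one (by omega : 2 * d ≤ n + 1), sum_insert (by simp)]
    have : (n + 1) ^ 2 = n ^ 2 + 2 * n + 1 := by ring
    omega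

/-- A state with many mergeable partners forces the triple rendezvous to come early. -/
theorem four_mul_le_of_mem_doubled (hV : 3 ≤ Fintype.card V) (hs : Sync Φ) (hc : Conn Φ)
    (h : NoTriple Φ b) (hv : v ∈ doubled Φ j) (htj : t + j ≤ b) :
    4 * (b + 1) + 4 * deg Φ t v ^ 2 + 4 * deg Φ t v
        ≤ 4 * j + Fintype.card V ^ 2 + 4 * Fintype.card V + 4 ∧
      deg Φ t v ≤ #(doubled Φ j) := by
  obtain ⟨w, hw, a, c, hac, ha, hcv⟩ := mem_doubled.1 hv
  have h1 : Disjoint ({u | Adj Φ t v u} : Finset V) (univ.image w) := by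
    rw [disjoint_left]
    intro u hu hu'
    obtain ⟨x, -, rfl⟩ := mem_image.1 hu'
    obtain ⟨hne, w', hw', e⟩ := (mem_filter.1 hu).2
    have hx : ∀ y, w y = v → y ≠ x := by
      rintro y rfl rfl
      exact hne rfl
    refine h.false_of_triple (w := w' ∘ w) (i := a) (j := c) (k := x)
      ((hw.comp hw').mono (by omega)) hac (hx a ha) (hx c hcv) ?_ ?_
    · simp [ha, hcv]
    · simp [ha, e]
  have h2 : deg Φ t v + #(univ.image w) ≤ Fintype.card V := by
    rw [deg, ← card_union_of_disjoint h1]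
    exact card_le_univ _
  have hj : NoTriple Φ j := h.mono (by omega)
  have h3 := two_mul_deficiency_le hj hw
  have h4 := succ_le_add_sum_levels hV hs hc h (j := j) (by omega)
  have h5 : Icc (Fintype.card V - defect Φ j) (Fintype.card V)
      ⊆ Icc (2 * deg Φ t v) (Fintype.card V) := Icc_subset_Icc_left (by omega)
  have h6 := sum_le_sum_of_subset (f := fun m => m / 2 + 1) h5
  have h7 := four_mul_sum_levels (d := deg Φ t v) (n := Fintype.card V) (by omega)
  refine ⟨by omega, ?_⟩
  have h8 : Fintype.card V ≤ #(univ.image w) + #(doubled Φ j) := by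
    have e1 : Fintype.card V = ∑ y ∈ univ.image w, #{i | w i = y} := by
      rw [← card_univ]
      exact card_eq_sum_card_fiberwise fun i hi => by simp
    have e2 : ∑ y ∈ univ.image w, #{i | w i = y}
        ≤ ∑ y ∈ univ.image w, (1 + if y ∈ doubled Φ j then 1 else 0) := by
      refine sum_le_sum fun y _ => ?_
      split_ifs with hy
      · exact hj w hw y
      · rw [add_zero, card_le_one]
        intro p hp q hq
        simp only [mem_filter, mem_univ, true_and] at hp hq
        by_contra hpq
        exact hy (mem_doubled.2 ⟨w, hw, p, q, hpq, hp, hq⟩)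
    rw [sum_add_distrib, sum_const, smul_eq_mul, mul_one, ← card_filter] at e2
    have e3 : #{y ∈ univ.image w | y ∈ doubled Φ j} ≤ #(doubled Φ j) :=
      card_le_card fun y hy => (mem_filter.1 hy).2
    omega
  omega

theorem mul_pred_le_two_mul_sum {f K : ℕ} (h : f ≤ K) :
    f * (f - 1) ≤ 2 * ∑ j ∈ Icc 1 K, (f - j) := by
  have h1 : ∑ j ∈ range f, (f - (j + 1)) ≤ ∑ j ∈ Icc 1 K, (f - j) := by
    rw [← sum_image (f := fun j => f - j) (g := fun j => j + 1) (by simp)]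
    refine sum_le_sum_of_subset fun j hj => ?_
    obtain ⟨i, hi, rfl⟩ := mem_image.1 hj
    rw [mem_range] at hi
    rw [mem_Icc]
    omega
  have h2 : ∑ j ∈ range f, (f - (j + 1)) = ∑ j ∈ range f, j := by
    rw [← sum_range_reflect (fun j => j)]
    refine sum_congr rfl fun j hj => ?_
    omega
  have h3 := sum_range_id_mul_two f
  omega

/-- Since the quadratic bound fails (`hY`), degree `s + 1` forces depth above `2 * s + 2`, and
degree `s + 2` depth above `4 * s + 6 ≥ n`, which is impossible. At small depth, `deg ≤ #(doubled Φ
j) ≤ n - (K - j)` is sharper and gives the truncated term on the left. -/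
theorem deg_add_le (hV : 3 ≤ Fintype.card V) (hs : Sync Φ) (hc : Conn Φ) (h : NoTriple Φ b)
    (hY : Fintype.card V ^ 2 + 4 * Fintype.card V + 4 < 4 * (b + 1) + 4 * s ^ 2 + 4 * s)
    (hn : Fintype.card V ≤ 4 * s + 6) (hv : t + depth Φ v ≤ b) :
    deg Φ t v + (s - (Fintype.card V - maxDepth Φ) - depth Φ v)
      ≤ s + if 2 * s + 3 ≤ depth Φ v then 1 else 0 := by
  obtain ⟨h1, h2⟩ := four_mul_le_of_mem_doubled hV hs hc h
    ((mem_doubled_iff_depth_le hV hs hc).2 le_rfl) hv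
  have h3 := card_doubled_add_le hV hs hc (j := depth Φ v)
  have h4 := depth_le_maxDepth (Φ := Φ) v
  have h5 := maxDepth_le hV hs hc
  have h6 : deg Φ t v ≤ s ∨ deg Φ t v = s + 1 ∨ s + 2 ≤ deg Φ t v := by omega
  rcases h6 with h6 | h6 | h6
  · split_ifs <;> omega
  · rw [h6] at h1
    have : 2 * s + 3 ≤ depth Φ v := by nlinarith
    rw [if_pos this]
    omega
  · exfalso
    have : (s + 2) ^ 2 ≤ deg Φ t v ^ 2 := Nat.pow_le_pow_left h6 2
    nlinarith

/-- This sums `deg_add_le` over all states at time `b - K`. Attained depths `1, ..., K` contribute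
the triangular term, and at most `n - (2 * s + 2)` states are deep enough for degree `s + 1`. -/
theorem four_mul_sub_maxDepth_add_le (hV : 3 ≤ Fintype.card V) (hs : Sync Φ) (hc : Conn Φ)
    (h : NoTriple Φ b) (hb : maxDepth Φ ≤ b) (hsn : s ≤ Fintype.card V)
    (hY : Fintype.card V ^ 2 + 4 * Fintype.card V + 4 < 4 * (b + 1) + 4 * s ^ 2 + 4 * s)
    (hn : Fintype.card V ≤ 4 * s + 6) :
    4 * (b - maxDepth Φ) + (s - (Fintype.card V - maxDepth Φ)) *
        (s - (Fintype.card V - maxDepth Φ) - 1)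
        + 2 * (if maxDepth Φ = Fintype.card V then 1 else 0)
      ≤ 2 * (Fintype.card V * s)
        + 2 * (if 2 * s + 3 ≤ maxDepth Φ then Fintype.card V - (2 * s + 2) else 0) := by
  set K := maxDepth Φ with hK
  set f := s - (Fintype.card V - K) with hf
  have hKn : K ≤ Fintype.card V := maxDepth_le hV hs hc
  have hdK : ∀ v, depth Φ v ≤ K := depth_le_maxDepth
  have hterm : ∀ v, deg Φ (b - K) v + (f - depth Φ v)
      ≤ s + if 2 * s + 3 ≤ depth Φ v then 1 else 0 := fun v =>
    deg_add_le hV hs hc h hY hn (by have := hdK v; omega)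
  have hsum : ∑ v, (deg Φ (b - K) v + (f - depth Φ v)) + (if K = Fintype.card V then 1 else 0)
      ≤ ∑ v, (s + if 2 * s + 3 ≤ depth Φ v then 1 else 0) := by
    -- When `K = n` all depths are distinct, so an edge appearing at time `b - K + 1` has an end of
    -- depth below `K`. There the bound still holds one step later, so it is strict at time `b - K`.
    split_ifs with hKV
    · rw [Nat.add_one_le_iff]
      have : Nonempty V := Fintype.card_pos_iff.1 (by omega)
      have hK1 : 1 ≤ K := (one_le_depth hV hs hc (Classical.arbitrary V)).trans (hdK _)
      obtain ⟨p, q, hpq, hn'⟩ := exists_new_adj hV hs (t := b - K) (h.mono (by omega))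
      have hlt : ∀ u, depth Φ u < K → deg Φ (b - K) u < deg Φ (b - K + 1) u →
          ∑ v, (deg Φ (b - K) v + (f - depth Φ v))
            < ∑ v, (s + if 2 * s + 3 ≤ depth Φ v then 1 else 0) := by
        intro u hu hu'
        refine sum_lt_sum (fun v _ => hterm v) ⟨u, mem_univ u, ?_⟩
        have := deg_add_le hV hs hc h hY hn (v := u) (t := b - K + 1) (by omega)
        rw [← hK, ← hf] at this
        omega
      by_cases hp : depth Φ p < K
      · exact hlt p hp (deg_lt (Nat.le_succ _) hpq hn')
      · refine hlt q ?_ (deg_lt (Nat.le_succ _) hpq.symm fun h => hn' h.symm)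
        by_contra hq
        have hinj : Set.InjOn (depth Φ) (univ : Finset V) := by
          refine injOn_of_surjOn_of_card_le (t := Icc 1 K) (depth Φ) ?_ ?_ ?_
          · intro v _
            exact mem_coe.2 (mem_Icc.2 ⟨one_le_depth hV hs hc v, hdK v⟩)
          · intro j hj
            obtain ⟨u, hu⟩ := exists_depth_eq_of_mem_Icc hV hs hc hj
            exact ⟨u, by simp, hu⟩
          · simp [hKV]
        have := hdK p
        have := hdK q
        exact hpq.1 (hinj (by simp) (by simp) (by omega))
    · exact sum_le_sum fun v _ => hterm v
  rw [sum_add_distrib, sum_add_distrib, sum_const, card_univ, smul_eq_mul, ← card_filter] at hsum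
  have h1 := two_mul_le_sum_deg hV hs (h.mono (by omega : b - K ≤ b))
  have h2 : ∑ j ∈ Icc 1 K, (f - j) ≤ ∑ v, (f - depth Φ v) := by
    have : Nonempty V := Fintype.card_pos_iff.1 (by omega)
    choose! u hu using fun j (hj : j ∈ Icc 1 K) => exists_depth_eq_of_mem_Icc hV hs hc hj
    have hui : Set.InjOn u (Icc 1 K) := fun i hi j hj hij => by
      rw [← hu i hi, ← hu j hj, hij]
    calc ∑ j ∈ Icc 1 K, (f - j) = ∑ j ∈ Icc 1 K, (f - depth Φ (u j)) :=
          sum_congr rfl fun j hj => by rw [hu j hj]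
      _ = ∑ v ∈ (Icc 1 K).image u, (f - depth Φ v) :=
          (sum_image (f := fun v => f - depth Φ v) hui).symm
      _ ≤ ∑ v, (f - depth Φ v) := sum_le_sum_of_subset (subset_univ _)
  have h3 := mul_pred_le_two_mul_sum (f := f) (K := K) (by omega)
  have h4 : #{v | 2 * s + 3 ≤ depth Φ v}
      ≤ if 2 * s + 3 ≤ K then Fintype.card V - (2 * s + 2) else 0 := by
    split_ifs with hsK
    · have e1 := card_le_card_filter_depth hV hs hc (J := Icc 1 (2 * s + 2))
        (Icc_subset_Icc_right (by omega))
      have e2 : Disjoint ({v | 2 * s + 3 ≤ depth Φ v} : Finset V)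
          ({v | depth Φ v ∈ Icc 1 (2 * s + 2)} : Finset V) := by
        rw [disjoint_left]
        intro v hv hv'
        simp at hv hv'
        omega
      have e3 := card_le_univ (({v | 2 * s + 3 ≤ depth Φ v} : Finset V) ∪
        ({v | depth Φ v ∈ Icc 1 (2 * s + 2)} : Finset V))
      rw [card_union_of_disjoint e2] at e3
      rw [Nat.card_Icc] at e1
      omega
    · rw [Nat.le_zero, card_eq_zero, filter_eq_empty_iff]
      intro v _
      have := hdK v
      omega
  omega

theorem two_mul_le_card_mul (hV : 3 ≤ Fintype.card V) (hs : Sync Φ) (h : NoTriple Φ b) :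
    2 * b ≤ Fintype.card V * (Fintype.card V - 1) := by
  refine (two_mul_le_sum_deg hV hs h).trans ?_
  calc ∑ i, deg Φ b i ≤ ∑ _i : V, (Fintype.card V - 1) :=
        sum_le_sum fun i _ => by have := deg_le (Φ := Φ) (t := b) i; omega
    _ = Fintype.card V * (Fintype.card V - 1) := by simp

end depth

/-! ### Arithmetic, and the choice of the parameter. -/

theorem false_of_bounds {n s b K : ℕ} (hs : 1 ≤ s) (hsn : 2 * s ≤ n)
    (hcross : n ^ 2 < 2 * n * (s + 1) + 4 * s ^ 2 + 12 * s + 4)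
    (hX : n * s + 2 * n < 2 * (b + 1))
    (hY : n ^ 2 + 4 * n + 4 < 4 * (b + 1) + 4 * s ^ 2 + 4 * s)
    (hb : 2 * b ≤ n * (n - 1)) (hKn : K ≤ n)
    (hmain : 4 * (b - K) + (s - (n - K)) * (s - (n - K) - 1) + 2 * (if K = n then 1 else 0)
      ≤ 2 * (n * s) + 2 * (if 2 * s + 3 ≤ K then n - (2 * s + 2) else 0)) : False := by
  obtain ⟨f, hf⟩ : ∃ f, f = s - (n - K) := ⟨_, rfl⟩
  rw [← hf] at hmain
  -- This is `(f - k) * (f - k - 1) ≥ 0`; such linear bounds on `f * (f - 1)` make the final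
  -- inequalities linear.
  have ht : ∀ k : ℕ, 2 * k * f ≤ f * (f - 1) + k * (k + 1) := by
    intro k
    rcases f with _ | f
    · simp
    · rw [Nat.add_sub_cancel]
      rcases Nat.lt_or_ge f k with h | h
      · obtain ⟨d, rfl⟩ := Nat.exists_eq_add_of_lt h
        nlinarith
      · obtain ⟨d, rfl⟩ := Nat.exists_eq_add_of_le h
        nlinarith [Nat.le_mul_self d]
  have t1 := ht 1
  have t2 := ht 2
  have t3 := ht 3
  generalize f * (f - 1) = F at *
  rcases Nat.lt_or_ge s 8 with h8 | h8
  · have hn : n < 4 * s + 7 := by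
      by_contra hcon
      nlinarith
    clear ht
    interval_cases s <;> interval_cases n <;> split_ifs at hmain <;> omega
  · have hn : n < 4 * s - 2 := by
      by_contra hcon
      obtain ⟨d, rfl⟩ := Nat.exists_eq_add_of_le (not_lt.1 hcon)
      obtain ⟨c, rfl⟩ := Nat.exists_eq_add_of_le h8
      have : 4 * (8 + c) - 2 = 30 + 4 * c := by omega
      rw [this] at hcross
      nlinarith
    have := mul_comm n s
    generalize n * s = P at *
    split_ifs at hmain <;> omega

/-- The bound on the triple rendezvous time, for transformations of a finite set. -/
theorem NoTriple.bound {V : Type*} [Fintype V] {Φ : Set (V → V)} {b s : ℕ}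
    (hV : 3 ≤ Fintype.card V) (hsync : Sync Φ) (hc : Conn Φ) (h : NoTriple Φ b)
    (hs : 1 ≤ s) (hsn : 2 * s ≤ Fintype.card V) :
    2 * (b + 1) ≤ Fintype.card V * s + 2 * Fintype.card V ∨
      4 * (b + 1) + 4 * s ^ 2 + 4 * s ≤ Fintype.card V ^ 2 + 4 * Fintype.card V + 4 := by
  by_contra! hcon
  obtain ⟨hX, hY⟩ := hcon
  set n := Fintype.card V with hn
  -- The third hypothesis says that at `r + 1` the quadratic bound is below the linear one.
  have key : ∀ r, 1 ≤ r → 2 * r ≤ n → n ^ 2 < 2 * n * (r + 1) + 4 * r ^ 2 + 12 * r + 4 →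
      n * r + 2 * n < 2 * (b + 1) → n ^ 2 + 4 * n + 4 < 4 * (b + 1) + 4 * r ^ 2 + 4 * r →
      False := by
    intro r hr hrn hcross hX hY
    have hK := maxDepth_le hV hsync hc
    have hnr : n * 1 ≤ n * r := Nat.mul_le_mul_left n hr
    have hn4 : n ≤ 4 * r + 6 := by
      by_contra hcon
      nlinarith
    exact false_of_bounds hr hrn hcross hX hY (two_mul_le_card_mul hV hsync h) hK
      (four_mul_sub_maxDepth_add_le hV hsync hc h (by omega) (by omega) hY hn4)
  by_cases hcross : n ^ 2 < 2 * n * (s + 1) + 4 * s ^ 2 + 12 * s + 4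
  · exact key s hs hsn hcross hX hY
  -- Otherwise pass to some `r > s` where the bounds are about to cross: at `r` the quadratic one is
  -- still at least the linear one, at `r + 1` no longer. Both bounds at `r` are then at most the
  -- quadratic bound at `s`.
  · obtain ⟨r, hsr, hr, hr'⟩ : ∃ r, s + 1 ≤ r ∧ 2 * n * r + 4 * r ^ 2 + 4 * r ≤ n ^ 2 + 4 ∧
        ¬ (2 * n * (r + 1) + 4 * (r + 1) ^ 2 + 4 * (r + 1) ≤ n ^ 2 + 4) := by
      by_contra! hall
      have : ∀ r, s + 1 ≤ r → 2 * n * r + 4 * r ^ 2 + 4 * r ≤ n ^ 2 + 4 := by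
        intro r hr
        induction r, hr using Nat.le_induction with
        | base => nlinarith
        | succ r hr ih => exact hall r hr ih
      have := this n (by omega)
      nlinarith
    refine key r (by omega) ?_ (by nlinarith) (by nlinarith) (by nlinarith)
    by_contra hcon
    nlinarith

/-! ### Translation between matrices and transformations. -/

/-- The matrix of a transformation. -/
def toMat {n : ℕ} (f : Fin n → Fin n) : Matrix (Fin n) (Fin n) ℝ :=
  Matrix.of fun i => Pi.single (f i) 1

theorem toMat_apply {n : ℕ} (f : Fin n → Fin n) (i j : Fin n) :
    toMat f i j = if f i = j then 1 else 0 := by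
  simp [toMat, Pi.single_apply, eq_comm]

theorem toMat_id {n : ℕ} : toMat (id : Fin n → Fin n) = 1 := by
  ext i j
  simp [toMat_apply, Matrix.one_apply]

theorem toMat_mul {n : ℕ} (f w : Fin n → Fin n) : toMat f * toMat w = toMat (w ∘ f) := by
  ext i j
  rw [Matrix.mul_apply, sum_eq_single (f i)]
  · simp [toMat_apply]
  · intro k _ hk
    simp [toMat_apply, Ne.symm hk]
  · simp

theorem exists_eq_toMat {n : ℕ} {L : Matrix (Fin n) (Fin n) ℝ}
    (h01 : ∀ i j, L i j = 0 ∨ L i j = 1) (hsum : ∀ i, ∑ j, L i j = 1) : ∃ f, L = toMat f := by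
  have h1 : ∀ i, ∃ j, L i j = 1 := by
    intro i
    by_contra! hcon
    have := hsum i
    rw [sum_eq_zero fun j _ => (h01 i j).resolve_right (hcon j)] at this
    exact zero_ne_one this
  choose f hf using h1
  refine ⟨f, ?_⟩
  ext i j
  rw [toMat_apply]
  split_ifs with hj
  · rw [← hj, hf]
  · refine (h01 i j).resolve_right fun hij => ?_
    have h2 : ∑ k ∈ {f i, j}, L i k ≤ ∑ k, L i k :=
      sum_le_sum_of_subset_of_nonneg (subset_univ _) fun k _ _ => by
        rcases h01 i k with h | h <;> simp [h]
    rw [sum_pair hj, hf, hij, hsum] at h2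
    norm_num at h2

variable {n : ℕ} {S : Set (Matrix (Fin n) (Fin n) ℝ)}

/-- The transformations induced by the letters of an automaton. -/
def letters (S : Set (Matrix (Fin n) (Fin n) ℝ)) : Set (Fin n → Fin n) := {f | toMat f ∈ S}

theorem mem_wordsOfLength_iff (hS : IsAutomaton S) {t : ℕ} {W : Matrix (Fin n) (Fin n) ℝ} :
    W ∈ wordsOfLength S t ↔ ∃ w, IsWord (letters S) t w ∧ W = toMat w := by
  constructor
  · rintro ⟨l, rfl, hl, rfl⟩
    induction l with
    | nil => exact ⟨id, IsWord.nil, by simp [toMat_id]⟩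
    | cons L l ih =>
      obtain ⟨w, hw, e⟩ := ih fun M hM => hl M (List.mem_cons_of_mem _ hM)
      have hL := hl L List.mem_cons_self
      obtain ⟨f, rfl⟩ := exists_eq_toMat (hS L hL).1 (hS L hL).2
      exact ⟨w ∘ f, IsWord.cons (w := w) (f := f) hL hw, by rw [List.prod_cons, e, toMat_mul]⟩
  · rintro ⟨w, hw, rfl⟩
    induction hw with
    | nil => exact ⟨[], rfl, by simp, by simp [toMat_id]⟩
    | @cons t w f hf _ ih =>
      obtain ⟨l, rfl, hl, e⟩ := ih
      refine ⟨toMat f :: l, rfl, ?_, by rw [List.prod_cons, e, toMat_mul]⟩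
      intro L hL
      rcases List.mem_cons.1 hL with rfl | hL
      · exact hf
      · exact hl L hL

theorem mem_tripleTimes_iff (hS : IsAutomaton S) {t : ℕ} :
    t ∈ tripleTimes S ↔ ∃ w, Reach (letters S) t w ∧ ∃ j, 3 ≤ #{i | w i = j} := by
  have hnorm : ∀ (w : Fin n → Fin n) j, hammingNorm (fun i => toMat w i j) = #{i | w i = j} := by
    intro w j
    simp [hammingNorm, toMat_apply]
  constructor
  · rintro ⟨v, ⟨W, ⟨r, hr, hW⟩, j, rfl⟩, h3⟩
    obtain ⟨w, hw, rfl⟩ := (mem_wordsOfLength_iff hS).1 hW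
    exact ⟨w, ⟨r, hr, hw⟩, j, by rwa [← hnorm]⟩
  · rintro ⟨w, ⟨r, hr, hw⟩, j, h3⟩
    exact ⟨_, ⟨toMat w, ⟨r, hr, (mem_wordsOfLength_iff hS).2 ⟨w, hw, rfl⟩⟩, j, rfl⟩,
      by rwa [hnorm]⟩

theorem sync_letters (hS : IsAutomaton S) (h : IsSynchronizing S) : Sync (letters S) := by
  obtain ⟨t, W, z, hW, e⟩ := h
  obtain ⟨w, hw, rfl⟩ := (mem_wordsOfLength_iff hS).1 hW
  refine ⟨t, w, z, hw, fun i => ?_⟩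
  have := congrFun (congrFun e i) z
  by_contra hne
  simp [toMat_apply, hne] at this

theorem conn_letters (hS : IsAutomaton S) (h : IsStronglyConnected S) : Conn (letters S) :=
  fun i j => Relation.ReflTransGen.mono (by
    rintro a c ⟨L, hL, hac⟩
    obtain ⟨f, rfl⟩ := exists_eq_toMat (hS L hL).1 (hS L hL).2
    refine ⟨f, hL, ?_⟩
    by_contra hne
    simp [toMat_apply, hne] at hac) i j (h i j)

end SyncAut

theorem mainTheorem4 (n : ℕ) (hn : 3 ≤ n) (S : Set (Matrix (Fin n) (Fin n) ℝ))
    (hS : IsAutomaton S) (hsync : IsSynchronizing S) (hconn : IsStronglyConnected S)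
    (s : ℕ) (hs1 : 1 ≤ s) (hs2 : (s : ℝ) ≤ (n : ℝ) / 2) :
    (tripleTimes S).Nonempty ∧
      (tripleRendezvousTime S : ℝ) ≤
        max ((n : ℝ) * ((s : ℝ) + 2) / 2)
          (((n : ℝ) * ((n : ℝ) + 4) - (2 * (s : ℝ) - 1) * (2 * (s : ℝ) + 3) + 1) / 4) := by
  have hsy := SyncAut.sync_letters hS hsync
  have hne : (tripleTimes S).Nonempty := by
    obtain ⟨t, w, z, hw, hz⟩ := hsy
    exact ⟨t, (SyncAut.mem_tripleTimes_iff hS).2 ⟨w, ⟨t, le_rfl, hw⟩, z, by simpa [hz] using hn⟩⟩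
  refine ⟨hne, ?_⟩
  rcases Nat.eq_zero_or_pos (tripleRendezvousTime S) with h0 | hpos
  · rw [h0, Nat.cast_zero]
    exact le_max_of_le_left (by positivity)
  · obtain ⟨b, hb⟩ : ∃ b, tripleRendezvousTime S = b + 1 := ⟨_, (Nat.succ_pred_eq_of_pos hpos).symm⟩
    have hnot : b ∉ tripleTimes S := fun h => by
      have : tripleRendezvousTime S ≤ b := Nat.sInf_le h
      omega
    have hno : SyncAut.NoTriple (SyncAut.letters S) b := by
      intro w hw j
      by_contra h3
      refine hnot ((SyncAut.mem_tripleTimes_iff hS).2 ⟨w, hw, j, ?_⟩)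
      rw [not_le, Nat.lt_iff_add_one_le] at h3
      convert h3
    have hs2' : 2 * s ≤ n := by
      have : (2 * s : ℝ) ≤ n := by linarith
      exact_mod_cast this
    have hbound := hno.bound (s := s) (by simpa using hn) hsy (SyncAut.conn_letters hS hconn) hs1
      (by simpa using hs2')
    rw [Fintype.card_fin] at hbound
    rw [hb]
    push_cast
    rcases hbound with h | h
    · refine le_max_of_le_left ?_
      have : (2 * (b + 1) : ℝ) ≤ n * s + 2 * n := by exact_mod_cast h
      linarith
    · refine le_max_of_le_right ?_
      have : (4 * (b + 1) + 4 * s ^ 2 + 4 * s : ℝ) ≤ n ^ 2 + 4 * n + 4 := by exact_mod_cast h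
      linarith
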